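/- Let $G=(V,E)$ be a finite simple graph with at least one vertex, with adjacency matrix $A$ and diagonal degree matrix $D$. Let $B$ be its non-backtracking matrix, indexed by the directed edges of $G$, with $B_{i\to j,\,k\to \ell}=1$ if $j=k$ and $i\neq \ell$, and $0$ otherwise. Let $\rho$ be the spectral radius of $B$ (with $\rho=0$ if $G$ has no edges), and for real $z$ let $$L(z)=z^2\mathbb{1}-zA+D-\mathbb{1}$$ be the deformed Laplacian. Let $m\ge 1$ be an integer and suppose that $G$ has girth at least $2m+1$ (the girth of a graph without cycles is $\infty$). Then for every real $z<0$, $$L(z)\not\succeq \Big((z+\sqrt\rho)^2-\frac{2\sqrt\rho\, z}{m}\Big)\mathbb{1},$$ that is, the smallest eigenvalue of $L(z)$ is strictly less than $(z+\sqrt\rho)^2-2\sqrt\rho\,z/m$. Moreover, there is a single positive semidefinite matrix $X\in\mathbb{R}^{V\times V}$ with $\operatorname{Tr}X=1$ such that, for every real $z<0$, $$\langle X,L(z)\rangle=\operatorname{Tr}(X\,L(z))\le (z+\sqrt\rho)^2-\frac{2\sqrt\rho\, z}{m}.$$ -/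

import Mathlib

/-- The non-backtracking matrix of a graph, indexed by its directed edges: the entry at
`(i → j, k → l)` is `1` if `j = k` and `i ≠ l`, and `0` otherwise. -/
def SimpleGraph.nonBacktrackingMatrix {V : Type*} [DecidableEq V] (G : SimpleGraph V)
    (R : Type*) [Zero R] [One R] : Matrix G.Dart G.Dart R :=
  Matrix.of fun e f => if e.snd = f.fst ∧ e.fst ≠ f.snd then 1 else 0

/-- The spectral radius `ρ` of the non-backtracking matrix: the largest modulus of its complex
eigenvalues (and `0` if the graph has no edges). -/
noncomputable def SimpleGraph.nonBacktrackingRadius {V : Type*} [Fintype V] [DecidableEq V]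
    (G : SimpleGraph V) [DecidableRel G.Adj] : ℝ :=
  (spectralRadius ℂ (G.nonBacktrackingMatrix ℂ)).toReal

/-- The deformed Laplacian (Bethe Hessian) `L(z) = z² 1 - z A + D - 1` at a real point `z`. -/
def SimpleGraph.deformedLaplacian {V : Type*} [Fintype V] [DecidableEq V]
    (G : SimpleGraph V) [DecidableRel G.Adj] (z : ℝ) : Matrix V V ℝ :=
  z ^ 2 • (1 : Matrix V V ℝ) - z • G.adjMatrix ℝ + G.degMatrix ℝ - 1

/-! Suppose ρ > 0 and let `w` ≥ 0 be a left Perron eigenvector of B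
(`Matrix.exists_nonneg_eigenvector`). Each directed edge e gets the trial vector F_e = ∑_{s<m} a^s
N_s(e,·) with a = -1/√ρ, where N_s(e,v) counts non-backtracking walks to v with s steps after e.
Below the girth these layers are 0/1 vectors with disjoint supports (`nonBacktrackingCount_mul`),
and A satisfies a three-term recurrence on them (`nonBacktrackingCount_succ_mul_adjMatrix`).

Hence the quadratic form of L(z) at F_e depends only on the layer sizes. Averaged against `w`, layer
s has size ρ^s ∑ w, so a²ρ = 1 gives every layer equal mass. The m layers contribute m(z² + ρ), and
the m - 1 links between consecutive layers contribute 2(m-1)√ρ z; the sum is m times the claimed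
bound. Thus X, the normalised `w`-average of F_e F_eᵀ, attains the bound with equality for every z.

For strictness, if L(z) - c were positive semidefinite at the bound c, some F_e would lie in its
kernel; but (L(z) - c)F_e takes the value -z ≠ 0 at the tail of e.

If ρ = 0, some vertex has degree at most 1 (`radius_pos_of_two_le_degree`), and its coordinate
vector replaces the trial vectors. -/

/-! ### Perron-Frobenius theory for nonnegative matrices -/

open Filter Topology in
-- By Gelfand's formula, ‖M^k‖ is eventually at most s^k for some s < t, so the entries are
-- dominated by a geometric series.
theorem Matrix.summable_pow_div_of_spectralRadius_lt {n : Type*} [Fintype n] [DecidableEq n]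
    (M : Matrix n n ℝ) {t : ℝ} (ht : spectralRadius ℂ (M.map Complex.ofReal) < ENNReal.ofReal t)
    (i j : n) : Summable fun k : ℕ => (M ^ k) i j / t ^ k := by
  let _ : NormedRing (Matrix n n ℂ) := Matrix.linftyOpNormedRing
  let _ : NormedAlgebra ℂ (Matrix n n ℂ) := Matrix.linftyOpNormedAlgebra
  have _ : CompleteSpace (Matrix n n ℂ) := FiniteDimensional.complete ℂ _
  set A := M.map Complex.ofReal with hA
  obtain ⟨s, hs, hst⟩ := ENNReal.lt_iff_exists_nnreal_btwn.1 ht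
  have ht0 : 0 < t := ENNReal.ofReal_pos.1 (pos_of_gt ht)
  have hst' : (s : ℝ) < t := by
    rwa [ENNReal.ofReal, ENNReal.coe_lt_coe, Real.lt_toNNReal_iff_coe_lt] at hst
  have hev := eventually_lt_of_limsup_lt
    ((spectrum.limsup_pow_nnnorm_pow_one_div_le_spectralRadius A).trans_lt hs)
  have hev2 : ∀ᶠ k : ℕ in atTop, ‖(M ^ k) i j / t ^ k‖ ≤ (s / t) ^ k := by
    filter_upwards [hev, eventually_gt_atTop 0] with k hk hk0
    have h1 : (‖A ^ k‖₊ : ENNReal) ≤ (s : ENNReal) ^ k := by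
      have h2 := ENNReal.rpow_le_rpow hk.le (Nat.cast_nonneg (α := ℝ) k)
      rwa [← ENNReal.rpow_mul, one_div_mul_cancel (by positivity), ENNReal.rpow_one,
        ENNReal.rpow_natCast] at h2
    have h1' : ‖A ^ k‖₊ ≤ s ^ k := by exact_mod_cast h1
    have h3 : ‖(A ^ k) i j‖₊ ≤ ‖A ^ k‖₊ := by
      rw [Matrix.linfty_opNNNorm_def]
      refine le_trans ?_ (Finset.le_sup (f := fun i => ∑ j, ‖(A ^ k) i j‖₊) (Finset.mem_univ i))
      exact Finset.single_le_sum (f := fun j => ‖(A ^ k) i j‖₊) (fun _ _ => zero_le)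
        (Finset.mem_univ j)
    have h4 : (A ^ k) i j = (((M ^ k) i j : ℝ) : ℂ) := by
      have : A ^ k = (M ^ k).map Complex.ofRealHom := (Matrix.map_pow (f := Complex.ofRealHom) M k).symm
      rw [this]; rfl
    have h5 : |(M ^ k) i j| ≤ (s : ℝ) ^ k := by
      have := h3.trans h1'
      rw [h4] at this
      have h6 : ‖(((M ^ k) i j : ℝ) : ℂ)‖ ≤ (s : ℝ) ^ k := by exact_mod_cast this
      simpa using h6
    rw [norm_div, Real.norm_eq_abs, norm_pow, Real.norm_of_nonneg ht0.le, div_pow]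
    gcongr
  refine Summable.of_norm_bounded_eventually_nat
    (summable_geometric_of_lt_one (by positivity) ((div_lt_one ht0).2 hst')) hev2

theorem Matrix.pow_nonneg_apply {n : Type*} [Fintype n] [DecidableEq n] {M : Matrix n n ℝ}
    (hM : ∀ i j, 0 ≤ M i j) (k : ℕ) (i j : n) : 0 ≤ (M ^ k) i j := by
  induction k generalizing j with
  | zero => rw [pow_zero, Matrix.one_apply]; split_ifs <;> norm_num
  | succ k ih =>
    rw [pow_succ, Matrix.mul_apply]
    exact Finset.sum_nonneg fun l _ => mul_nonneg (ih l) (hM l j)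

/-- The solution `x` of `M x = t x - y` given by the Neumann series. -/
theorem Matrix.exists_nonneg_resolvent {n : Type*} [Fintype n] [DecidableEq n]
    {M : Matrix n n ℝ} (hM : ∀ i j, 0 ≤ M i j) {t r : ℝ} (hr : 0 ≤ r) (hrt : r < t)
    (ht : spectralRadius ℂ (M.map Complex.ofReal) < ENNReal.ofReal t)
    {y : n → ℝ} (hMy : r • y ≤ M.mulVec y) :
    ∃ x : n → ℝ, M.mulVec x = t • x - y ∧ ∀ i, y i / (t - r) ≤ x i := by
  have ht0 : 0 < t := hr.trans_lt hrt
  have hsum : ∀ i, Summable fun k : ℕ => ((M ^ k).mulVec y) i / t ^ k := by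
    intro i
    have := summable_sum (s := Finset.univ) fun j _ =>
      (M.summable_pow_div_of_spectralRadius_lt ht i j).mul_right (y j)
    refine this.congr fun k => ?_
    simp only [Matrix.mulVec, dotProduct, Finset.sum_div]
    exact Finset.sum_congr rfl fun j _ => by ring
  -- Subinvariance iterates because `M` is nonnegative; the Neumann series then dominates a
  -- geometric series, whence the lower bound y/(t - r).
  have hpow : ∀ k i, r ^ k * y i ≤ ((M ^ k).mulVec y) i := by
    intro k
    induction k with
    | zero => simp
    | succ k ih =>
      intro i
      rw [pow_succ' M, ← Matrix.mulVec_mulVec]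
      calc r ^ (k + 1) * y i = r ^ k * (r • y) i := by simp; ring
        _ ≤ r ^ k * (M.mulVec y) i := by gcongr; exact hMy i
        _ = ∑ j, M i j * (r ^ k * y j) := by
            simp only [Matrix.mulVec, dotProduct, Finset.mul_sum]
            exact Finset.sum_congr rfl fun j _ => by ring
        _ ≤ _ := by
            simp only [Matrix.mulVec, dotProduct] at ih ⊢
            exact Finset.sum_le_sum fun j _ => mul_le_mul_of_nonneg_left (ih j) (hM i j)
  refine ⟨fun i => t⁻¹ * ∑' k : ℕ, ((M ^ k).mulVec y) i / t ^ k, ?_, ?_⟩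
  · ext i
    have h1 : ∑ j, M i j * ∑' k : ℕ, ((M ^ k).mulVec y) j / t ^ k =
        ∑' k : ℕ, ((M ^ (k + 1)).mulVec y) i / t ^ k := by
      simp_rw [← tsum_mul_left]
      rw [← Summable.tsum_finsetSum fun j _ => (hsum j).mul_left _]
      refine tsum_congr fun k => ?_
      rw [pow_succ', ← Matrix.mulVec_mulVec]
      conv_rhs => rw [Matrix.mulVec, dotProduct, Finset.sum_div]
      exact Finset.sum_congr rfl fun j _ => by ring
    have h2 := (hsum i).tsum_eq_zero_add
    have h3 : ∑' k : ℕ, ((M ^ (k + 1)).mulVec y) i / t ^ k =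
        t * ∑' k : ℕ, ((M ^ (k + 1)).mulVec y) i / t ^ (k + 1) := by
      rw [← tsum_mul_left]
      refine tsum_congr fun k => ?_
      field_simp
      ring
    have h4 : M.mulVec (fun i => t⁻¹ * ∑' k : ℕ, ((M ^ k).mulVec y) i / t ^ k) i =
        t⁻¹ * ∑ j, M i j * ∑' k : ℕ, ((M ^ k).mulVec y) j / t ^ k := by
      rw [Matrix.mulVec, dotProduct, Finset.mul_sum]
      exact Finset.sum_congr rfl fun j _ => by ring
    rw [h4, h1, h3]
    simp only [Pi.sub_apply, Pi.smul_apply, smul_eq_mul]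
    rw [h2]
    simp
    field_simp
    ring
  · intro i
    have hlt : r / t < 1 := (div_lt_one ht0).2 hrt
    have hge : ∑' k : ℕ, (r / t) ^ k * y i ≤ ∑' k : ℕ, ((M ^ k).mulVec y) i / t ^ k := by
      refine Summable.tsum_le_tsum (fun k => ?_)
        ((summable_geometric_of_lt_one (by positivity) hlt).mul_right _) (hsum i)
      rw [div_pow, div_mul_eq_mul_div]
      gcongr
      exact hpow k i
    rw [tsum_mul_right, tsum_geometric_of_lt_one (by positivity) hlt] at hge
    calc y i / (t - r) = t⁻¹ * ((1 - r / t)⁻¹ * y i) := by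
          have : t - r ≠ 0 := (sub_pos.2 hrt).ne'
          field_simp
      _ ≤ _ := mul_le_mul_of_nonneg_left hge (inv_nonneg.2 ht0.le)

open Filter Topology in
/-- Weak Perron-Frobenius theorem. -/
theorem Matrix.exists_nonneg_eigenvector {n : Type*} [Fintype n] [DecidableEq n] [Nonempty n]
    {M : Matrix n n ℝ} (hM : ∀ i j, 0 ≤ M i j) :
    ∃ w : n → ℝ, 0 ≤ w ∧ w ≠ 0 ∧
      M.mulVec w = (spectralRadius ℂ (M.map Complex.ofReal)).toReal • w := by
  set A := M.map Complex.ofReal with hA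
  obtain ⟨μ, hμ, hμr⟩ : ∃ μ ∈ spectrum ℂ A, (‖μ‖₊ : ENNReal) = spectralRadius ℂ A := by
    let _ : NormedRing (Matrix n n ℂ) := Matrix.linftyOpNormedRing
    let _ : NormedAlgebra ℂ (Matrix n n ℂ) := Matrix.linftyOpNormedAlgebra
    have _ : CompleteSpace (Matrix n n ℂ) := FiniteDimensional.complete ℂ _
    exact spectrum.exists_nnnorm_eq_spectralRadius A
  set r := (spectralRadius ℂ A).toReal with hr
  have hμn : ‖μ‖ = r := by rw [hr, ← hμr]; simp
  have hr0 : 0 ≤ r := ENNReal.toReal_nonneg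
  have hrad : ∀ t, r < t → spectralRadius ℂ A < ENNReal.ofReal t := by
    intro t ht
    rw [← hμr, ← ENNReal.ofReal_coe_nnreal, ENNReal.ofReal_lt_ofReal_iff (hr0.trans_lt ht)]
    simpa [hμn] using ht
  obtain ⟨v, hv0, hv⟩ : ∃ v : n → ℂ, v ≠ 0 ∧ A.mulVec v = μ • v := by
    rw [spectrum.mem_iff, Matrix.isUnit_iff_isUnit_det, isUnit_iff_ne_zero, not_not,
      ← Matrix.exists_mulVec_eq_zero_iff] at hμ
    obtain ⟨v, hv0, hv⟩ := hμ
    refine ⟨v, hv0, ?_⟩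
    rw [Matrix.sub_mulVec, sub_eq_zero, Algebra.algebraMap_eq_smul_one, Matrix.smul_mulVec,
      Matrix.one_mulVec] at hv
    exact hv.symm
  -- By the triangle inequality, the moduli of an eigenvector for an extremal eigenvalue form a
  -- subinvariant vector.
  let y : n → ℝ := fun i => ‖v i‖
  have hy : 0 ≤ y := fun i => norm_nonneg _
  have hMy : r • y ≤ M.mulVec y := by
    intro i
    have h := congrFun hv i
    calc (r • y) i = ‖(μ • v) i‖ := by simp [y, hμn]
      _ = ‖∑ j, A i j * v j‖ := by rw [← h]; rfl
      _ ≤ ∑ j, ‖A i j * v j‖ := norm_sum_le _ _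
      _ = M.mulVec y i := by
        rw [Matrix.mulVec, dotProduct]
        exact Finset.sum_congr rfl fun j _ => by simp [hA, y, abs_of_nonneg (hM i j)]
  obtain ⟨i₀, hi₀⟩ : ∃ i, v i ≠ 0 := Function.ne_iff.1 hv0
  have hy₀ : 0 < y i₀ := norm_pos_iff.2 hi₀
  have hε : ∀ k : ℕ, (0 : ℝ) < 1 / ((k : ℝ) + 1) := fun k => by positivity
  choose x hx hxy using fun k : ℕ => Matrix.exists_nonneg_resolvent hM hr0
    (t := r + 1 / ((k : ℝ) + 1)) (by linarith [hε k]) (hrad _ (by linarith [hε k])) hMy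
  have hx0 : ∀ k i, 0 ≤ x k i := fun k i =>
    le_trans (div_nonneg (hy i) (by linarith [hε k])) (hxy k i)
  -- The resolvent at t = r + 1/(k+1) blows up as t decreases to r, so the term `y` vanishes in the
  -- limit once `x k` is normalised to the simplex.
  have hxs : ∀ k : ℕ, ((k : ℝ) + 1) * y i₀ ≤ ∑ i, x k i := by
    intro k
    refine le_trans ?_ (Finset.single_le_sum (fun i _ => hx0 k i) (Finset.mem_univ i₀))
    refine le_trans (le_of_eq ?_) (hxy k i₀)
    field_simp
    ring
  have hpos : ∀ k, 0 < ∑ i, x k i := fun k => lt_of_lt_of_le (by positivity) (hxs k)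
  let u : ℕ → n → ℝ := fun k => (∑ i, x k i)⁻¹ • x k
  have hu : ∀ k, u k ∈ stdSimplex ℝ n := fun k =>
    ⟨fun i => mul_nonneg (inv_nonneg.2 (hpos k).le) (hx0 k i), by
      simp only [u, Pi.smul_apply, smul_eq_mul, ← Finset.mul_sum]
      exact inv_mul_cancel₀ (hpos k).ne'⟩
  have hMu : ∀ k : ℕ, M.mulVec (u k) =
      (r + 1 / ((k : ℝ) + 1)) • u k - (∑ i, x k i)⁻¹ • y := by
    intro k
    simp only [u]
    rw [Matrix.mulVec_smul, hx, smul_sub, smul_comm]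
  obtain ⟨w, hw, φ, hφ, hlim⟩ := (isCompact_stdSimplex ℝ n).tendsto_subseq hu
  have hw0 : w ≠ 0 := by
    rintro rfl
    simpa using hw.2
  refine ⟨w, hw.1, hw0, ?_⟩
  have hinv : Tendsto (fun k => (∑ i, x k i)⁻¹) atTop (𝓝 0) := by
    refine tendsto_inv_atTop_zero.comp (tendsto_atTop_mono hxs ?_)
    exact (tendsto_atTop_add_const_right _ _ tendsto_natCast_atTop_atTop).atTop_mul_const hy₀
  have h1 : Tendsto (fun k => M.mulVec (u (φ k))) atTop (𝓝 (M.mulVec w)) :=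
    ((Continuous.matrix_mulVec continuous_const continuous_id).tendsto w).comp hlim
  have h2 : Tendsto (fun k => M.mulVec (u (φ k))) atTop (𝓝 (r • w)) := by
    simp_rw [hMu]
    have h3 : Tendsto (fun k : ℕ => r + 1 / ((φ k : ℝ) + 1)) atTop (𝓝 (r + 0)) :=
      (tendsto_one_div_add_atTop_nhds_zero_nat.comp hφ.tendsto_atTop).const_add r
    have h4 := (h3.smul hlim).sub ((hinv.comp hφ.tendsto_atTop).smul_const y)
    simpa using h4
  exact tendsto_nhds_unique h1 h2

/-! ### Non-backtracking walks below the girth are paths -/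

namespace SimpleGraph

variable {V : Type*} [Fintype V] [DecidableEq V] (G : SimpleGraph V) [DecidableRel G.Adj]

omit [Fintype V] [DecidableRel G.Adj] in
theorem nonBacktrackingMatrix_apply (e f : G.Dart) : G.nonBacktrackingMatrix ℝ e f =
    if e.snd = f.fst ∧ e.fst ≠ f.snd then 1 else 0 := rfl

omit [Fintype V] [DecidableRel G.Adj] in
theorem nonBacktrackingMatrix_nonneg (e f : G.Dart) : 0 ≤ G.nonBacktrackingMatrix ℝ e f := by
  rw [nonBacktrackingMatrix_apply]
  split_ifs <;> norm_num

omit [Fintype V] [DecidableRel G.Adj] in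
theorem nonBacktrackingMatrix_symm (e f : G.Dart) :
    G.nonBacktrackingMatrix ℝ f.symm e.symm = G.nonBacktrackingMatrix ℝ e f := by
  simp only [nonBacktrackingMatrix_apply]
  exact if_congr ⟨fun h => ⟨h.1.symm, h.2.symm⟩, fun h => ⟨h.1.symm, h.2.symm⟩⟩ rfl rfl

/-- Reversal of walks; it is used to join two walks with a common end. -/
theorem nonBacktrackingMatrix_pow_symm (k : ℕ) (e f : G.Dart) :
    (G.nonBacktrackingMatrix ℝ ^ k) f.symm e.symm = (G.nonBacktrackingMatrix ℝ ^ k) e f := by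
  induction k generalizing e with
  | zero => simp [Matrix.one_apply, Dart.symm_involutive.injective.eq_iff, eq_comm]
  | succ k ih =>
    conv_lhs => rw [pow_succ, Matrix.mul_apply]
    conv_rhs => rw [pow_succ', Matrix.mul_apply]
    refine Fintype.sum_equiv ⟨Dart.symm, Dart.symm, Dart.symm_symm, Dart.symm_symm⟩ _ _ fun g => ?_
    simp only [Equiv.coe_fn_mk]
    rw [← ih, ← G.nonBacktrackingMatrix_symm e, Dart.symm_symm, mul_comm]

omit [Fintype V] [DecidableEq V] [DecidableRel G.Adj] in
variable {G} in
-- The only obstruction is that `p` already uses the edge uv. A path visits its start v only once,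
-- so that edge would have to be its first step, making u its second vertex.
theorem Walk.IsPath.isCycle_cons_of_snd_ne {u v : V} {p : G.Walk v u} (hp : p.IsPath)
    (h : G.Adj u v) (hs : p.snd ≠ u) : (Walk.cons h p).IsCycle := by
  rw [Walk.cons_isCycle_iff]
  refine ⟨hp, fun he => ?_⟩
  cases p with
  | nil => exact h.ne rfl
  | cons h' p =>
    rw [Walk.cons_isPath_iff] at hp
    rw [Walk.edges_cons, List.mem_cons] at he
    rcases he with he | he
    · have hy := Sym2.congr_right.1 (Sym2.eq_swap.trans he)
      exact hs ((Walk.snd_cons p h').trans hy.symm)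
    · exact hp.2 (p.snd_mem_support_of_mem_edges he)

/-- Edges are prepended one at a time. If the new vertex already lies on the path, the segment up to
it closes with the new edge to a cycle shorter than the girth. The exponent k counts steps after the
first edge, so the walk has k + 1 edges. -/
theorem exists_isPath_of_nonBacktrackingMatrix_pow_ne_zero {k : ℕ} {a b : G.Dart}
    (hk : ((k + 1 : ℕ) : ℕ∞) < G.egirth) (h : (G.nonBacktrackingMatrix ℝ ^ k) a b ≠ 0) :
    ∃ p : G.Walk a.fst b.snd, p.IsPath ∧ p.length = k + 1 ∧ p.snd = a.snd := by
  induction k generalizing a with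
  | zero =>
    obtain rfl : a = b := by
      by_contra hab
      exact h (by simp [hab])
    exact ⟨Walk.cons a.adj Walk.nil, by simp [a.adj.ne], rfl, rfl⟩
  | succ k ih =>
    rw [pow_succ', Matrix.mul_apply] at h
    obtain ⟨c, -, hc⟩ := Finset.exists_ne_zero_of_sum_ne_zero h
    obtain ⟨hac, hcb⟩ := mul_ne_zero_iff.1 hc
    rw [nonBacktrackingMatrix_apply, ne_eq, ite_eq_right_iff, Classical.not_imp] at hac
    obtain ⟨⟨hac1, hac2⟩, -⟩ := hac
    obtain ⟨p, hp, hpl, hps⟩ := ih (lt_of_le_of_lt (by exact_mod_cast Nat.le_succ _) hk) hcb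
    have hadj : G.Adj a.fst c.fst := hac1 ▸ a.adj
    refine ⟨Walk.cons hadj p, ?_, by simp [hpl], by simp [hac1]⟩
    rw [Walk.cons_isPath_iff]
    refine ⟨hp, fun hmem => ?_⟩
    have hq := hp.takeUntil hmem
    have hqs := Walk.snd_takeUntil hadj.ne p hmem
    have hql := p.length_takeUntil_le_length hmem
    generalize p.takeUntil a.fst hmem = q at hq hqs hql
    have hcyc := hq.isCycle_cons_of_snd_ne hadj (by rw [hqs, hps]; exact hac2.symm)
    have hle := egirth_le_length hcyc
    refine absurd (hle.trans ?_) (not_le.2 hk)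
    rw [Walk.length_cons]
    exact_mod_cast (by omega)

theorem fst_ne_snd_of_nonBacktrackingMatrix_pow_ne_zero {k : ℕ} {a b : G.Dart}
    (hk : ((k + 1 : ℕ) : ℕ∞) < G.egirth) (h : (G.nonBacktrackingMatrix ℝ ^ k) a b ≠ 0) :
    a.fst ≠ b.snd := by
  obtain ⟨p, hp, hpl, -⟩ := G.exists_isPath_of_nonBacktrackingMatrix_pow_ne_zero hk h
  generalize b.snd = v at p
  rintro rfl
  rw [Walk.length_eq_zero_iff.2 (Walk.isPath_iff_nil.1 hp)] at hpl
  exact k.succ_ne_zero hpl.symm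

/-! ### Walk counts and the disjointness of layers -/

/-- The incidence matrix between directed edges and their heads. -/
def headMatrix : Matrix G.Dart V ℝ := Matrix.of fun e v => if e.snd = v then 1 else 0

/-- The incidence matrix between directed edges and their tails. -/
def tailMatrix : Matrix G.Dart V ℝ := Matrix.of fun e v => if e.fst = v then 1 else 0

/-- The number of non-backtracking walks with `s` steps after the directed edge `e` that end
at the vertex `v`. -/
def nonBacktrackingCount (s : ℕ) : Matrix G.Dart V ℝ :=
  G.nonBacktrackingMatrix ℝ ^ s * G.headMatrix

theorem nonBacktrackingCount_zero_apply (e : G.Dart) (v : V) :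
    G.nonBacktrackingCount 0 e v = if e.snd = v then 1 else 0 := by
  simp [nonBacktrackingCount, headMatrix]

theorem nonBacktrackingCount_succ (s : ℕ) :
    G.nonBacktrackingCount (s + 1) = G.nonBacktrackingMatrix ℝ * G.nonBacktrackingCount s := by
  rw [nonBacktrackingCount, nonBacktrackingCount, pow_succ', Matrix.mul_assoc]

variable {G} in
theorem exists_of_nonBacktrackingCount_ne_zero {s : ℕ} {e : G.Dart} {v : V}
    (h : G.nonBacktrackingCount s e v ≠ 0) :
    ∃ f : G.Dart, f.snd = v ∧ (G.nonBacktrackingMatrix ℝ ^ s) e f ≠ 0 := by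
  rw [nonBacktrackingCount, Matrix.mul_apply] at h
  obtain ⟨f, -, hf⟩ := Finset.exists_ne_zero_of_sum_ne_zero h
  obtain ⟨h1, h2⟩ := mul_ne_zero_iff.1 hf
  refine ⟨f, ?_, h1⟩
  by_contra hne
  exact h2 (by simp [headMatrix, hne])

theorem nonBacktrackingCount_fst {s : ℕ} (hs : ((s + 1 : ℕ) : ℕ∞) < G.egirth) (e : G.Dart) :
    G.nonBacktrackingCount s e e.fst = 0 := by
  by_contra h
  obtain ⟨f, hf, hpow⟩ := exists_of_nonBacktrackingCount_ne_zero h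
  exact G.fst_ne_snd_of_nonBacktrackingMatrix_pow_ne_zero hs hpow hf.symm

theorem nonBacktrackingMatrix_pow_add_ne_zero {s t : ℕ} {e f g : G.Dart}
    (h1 : (G.nonBacktrackingMatrix ℝ ^ s) e f ≠ 0) (h2 : (G.nonBacktrackingMatrix ℝ ^ t) f g ≠ 0) :
    (G.nonBacktrackingMatrix ℝ ^ (s + t)) e g ≠ 0 := by
  have hn := fun k => Matrix.pow_nonneg_apply G.nonBacktrackingMatrix_nonneg k
  rw [pow_add, Matrix.mul_apply]
  refine (lt_of_lt_of_le ?_ (Finset.single_le_sum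
    (fun l _ => mul_nonneg (hn s e l) (hn t l g)) (Finset.mem_univ f))).ne'
  exact mul_pos ((hn s e f).lt_of_ne' h1) ((hn t f g).lt_of_ne' h2)

/-- Reversing the walk that starts with `f` and continuing through `g` would give a closed
non-backtracking walk at `v` with s + t + 2 edges. -/
theorem nonBacktrackingCount_mul_eq_zero_of_ne {s t : ℕ}
    (hst : ((s + t + 2 : ℕ) : ℕ∞) < G.egirth) {f g : G.Dart} (hfst : f.fst = g.fst) (hne : f ≠ g)
    (v : V) : G.nonBacktrackingCount s f v * G.nonBacktrackingCount t g v = 0 := by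
  by_contra h
  obtain ⟨h1, h2⟩ := mul_ne_zero_iff.1 h
  obtain ⟨x, hx, hfx⟩ := exists_of_nonBacktrackingCount_ne_zero h1
  obtain ⟨y, hy, hgy⟩ := exists_of_nonBacktrackingCount_ne_zero h2
  rw [← nonBacktrackingMatrix_pow_symm] at hfx
  have hfg : (G.nonBacktrackingMatrix ℝ ^ 1) f.symm g ≠ 0 := by
    have : f.snd ≠ g.snd := fun h => hne (Dart.ext _ _ (Prod.ext hfst h))
    rw [pow_one, nonBacktrackingMatrix_apply, if_pos ⟨hfst, this⟩]
    exact one_ne_zero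
  have := G.nonBacktrackingMatrix_pow_add_ne_zero
    (G.nonBacktrackingMatrix_pow_add_ne_zero hfx hfg) hgy
  refine G.fst_ne_snd_of_nonBacktrackingMatrix_pow_ne_zero ?_ this (hx.trans hy.symm)
  rwa [show s + 1 + t + 1 = s + t + 2 by ring]

/-- Deleting `e` from a walk that returns to `e.snd` leaves a closed non-backtracking walk with t +
1 edges. -/
theorem nonBacktrackingCount_zero_mul_succ {t : ℕ} (ht : ((t + 1 : ℕ) : ℕ∞) < G.egirth)
    (e : G.Dart) (v : V) :
    G.nonBacktrackingCount 0 e v * G.nonBacktrackingCount (t + 1) e v = 0 := by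
  rw [nonBacktrackingCount_zero_apply]
  split_ifs with hev
  · rw [nonBacktrackingCount_succ, Matrix.mul_apply, one_mul]
    refine Finset.sum_eq_zero fun f _ => ?_
    rw [nonBacktrackingMatrix_apply]
    split_ifs with hef
    · rw [← hev, hef.1, G.nonBacktrackingCount_fst ht, mul_zero]
    · rw [zero_mul]
  · rw [zero_mul]

/-- Below the girth, a non-backtracking walk is determined by its first edge and its end. -/
theorem nonBacktrackingCount_mul {s t : ℕ} (hst : ((s + t : ℕ) : ℕ∞) < G.egirth) (e : G.Dart)
    (v : V) : G.nonBacktrackingCount s e v * G.nonBacktrackingCount t e v =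
      if s = t then G.nonBacktrackingCount s e v else 0 := by
  induction s generalizing t e with
  | zero =>
    cases t with
    | zero => simp [nonBacktrackingCount_zero_apply]
    | succ t => simpa using G.nonBacktrackingCount_zero_mul_succ (by simpa using hst) e v
  | succ s ih =>
    cases t with
    | zero => rw [mul_comm]; simpa using G.nonBacktrackingCount_zero_mul_succ (by simpa using hst) e v
    | succ t =>
      have hst2 : ((s + t + 2 : ℕ) : ℕ∞) < G.egirth := by
        rwa [show s + t + 2 = s + 1 + (t + 1) by ring]
      have hst0 : ((s + t : ℕ) : ℕ∞) < G.egirth := lt_of_le_of_lt (by norm_cast; omega) hst2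
      -- Distinct second edges cannot lead to the same end, so only the diagonal terms survive, and
      -- there the induction hypothesis applies with `s` and `t`.
      have key : ∀ f g : G.Dart,
          G.nonBacktrackingMatrix ℝ e f * G.nonBacktrackingCount s f v *
            (G.nonBacktrackingMatrix ℝ e g * G.nonBacktrackingCount t g v) =
          if f = g then G.nonBacktrackingMatrix ℝ e f *
            (if s = t then G.nonBacktrackingCount s f v else 0) else 0 := by
        intro f g
        rw [nonBacktrackingMatrix_apply, nonBacktrackingMatrix_apply]
        by_cases hf : e.snd = f.fst ∧ e.fst ≠ f.snd
        · by_cases hg : e.snd = g.fst ∧ e.fst ≠ g.snd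
          · rw [if_pos hf, if_pos hg, one_mul, one_mul, one_mul]
            by_cases hfg : f = g
            · subst hfg
              rw [if_pos rfl, ih hst0 f]
            · rw [if_neg hfg]
              exact G.nonBacktrackingCount_mul_eq_zero_of_ne hst2 (hf.1.symm.trans hg.1) hfg v
          · have : f ≠ g := by rintro rfl; exact hg hf
            rw [if_neg hg, if_neg this]; ring
        · rw [if_neg hf]; simp
      rw [nonBacktrackingCount_succ, nonBacktrackingCount_succ, Matrix.mul_apply, Matrix.mul_apply,
        Finset.sum_mul_sum]
      simp_rw [key]
      simp only [Finset.sum_ite_eq, Finset.mem_univ, if_true, Nat.add_right_cancel_iff]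
      split_ifs <;> simp

/-! ### Relations between the non-backtracking and adjacency matrices -/

omit [DecidableEq V] in
theorem sum_dart_eq (φ : V → V → ℝ) :
    ∑ d : G.Dart, φ d.fst d.snd = ∑ u, ∑ v, if G.Adj u v then φ u v else 0 := by
  rw [← Fintype.sum_prod_type' (f := fun u v => if G.Adj u v then φ u v else 0),
    ← Finset.sum_filter]
  exact Finset.sum_bij (fun d _ => d.toProd) (fun d _ => by simp [d.adj])
    (fun d _ d' _ h => Dart.ext _ _ h) (fun p hp => ⟨⟨p, by simpa using hp⟩, by simp, rfl⟩)
    (fun d _ => rfl)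

theorem sum_nonBacktrackingMatrix_mul (e : G.Dart) (ψ : V → ℝ) :
    ∑ f, G.nonBacktrackingMatrix ℝ e f * ψ f.snd =
      (∑ u, if G.Adj e.snd u then ψ u else 0) - ψ e.fst := by
  simp_rw [nonBacktrackingMatrix_apply]
  rw [G.sum_dart_eq fun u v => (if e.snd = u ∧ e.fst ≠ v then 1 else 0) * ψ v,
    Finset.sum_eq_single_of_mem e.snd (Finset.mem_univ _)
      fun u _ hu => Finset.sum_eq_zero fun v _ => by simp [hu.symm],
    eq_sub_iff_add_eq, ← Fintype.sum_ite_eq e.fst fun u => ψ u, ← Finset.sum_add_distrib]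
  refine Finset.sum_congr rfl fun u _ => ?_
  by_cases h : e.fst = u
  · subst h
    simp [e.adj.symm]
  · simp [h]

theorem sum_nonBacktrackingMatrix (e : G.Dart) :
    ∑ f, G.nonBacktrackingMatrix ℝ e f = (G.degree e.snd : ℝ) - 1 := by
  have h := G.sum_nonBacktrackingMatrix_mul e fun _ => 1
  simpa only [mul_one, Finset.sum_boole, ← G.neighborFinset_eq_filter,
    G.card_neighborFinset_eq_degree] using h

/-- A step from the head of `e` either continues without backtracking or returns to the tail. With
`nonBacktrackingMatrix_mul_tailMatrix` this is the linear algebra behind the Ihara-Bass formula. -/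
theorem headMatrix_mul_adjMatrix :
    G.headMatrix * G.adjMatrix ℝ =
      G.nonBacktrackingMatrix ℝ * G.headMatrix + G.tailMatrix := by
  ext e u
  have h := G.sum_nonBacktrackingMatrix_mul e fun x => if x = u then 1 else 0
  have h1 : (G.headMatrix * G.adjMatrix ℝ) e u = if G.Adj e.snd u then 1 else 0 := by
    simp only [Matrix.mul_apply, headMatrix, Matrix.of_apply, adjMatrix_apply, ite_mul, one_mul,
      zero_mul, Finset.sum_ite_eq, Finset.mem_univ, if_true]
  rw [h1, Matrix.add_apply, Matrix.mul_apply]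
  simp only [headMatrix, tailMatrix, Matrix.of_apply]
  rw [h, sub_add_cancel, Finset.sum_eq_single_of_mem u (Finset.mem_univ _)
    fun x _ hx => by simp [hx], if_pos rfl]

theorem nonBacktrackingMatrix_mul_tailMatrix :
    G.nonBacktrackingMatrix ℝ * G.tailMatrix =
      G.headMatrix * Matrix.diagonal fun u => (G.degree u : ℝ) - 1 := by
  ext e u
  rw [Matrix.mul_diagonal, Matrix.mul_apply]
  have : ∀ f, G.nonBacktrackingMatrix ℝ e f * G.tailMatrix f u =
      G.nonBacktrackingMatrix ℝ e f * G.headMatrix e u := by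
    intro f
    rw [nonBacktrackingMatrix_apply]
    split_ifs with h
    · simp [tailMatrix, headMatrix, h.1]
    · simp
  simp_rw [this]
  rw [← Finset.sum_mul, sum_nonBacktrackingMatrix, mul_comm]
  simp only [headMatrix, Matrix.of_apply]
  split_ifs with h
  · rw [h]
  · simp

theorem nonBacktrackingCount_zero_mul_adjMatrix :
    G.nonBacktrackingCount 0 * G.adjMatrix ℝ = G.nonBacktrackingCount 1 + G.tailMatrix := by
  simp [nonBacktrackingCount, headMatrix_mul_adjMatrix]

/-- Three-term recurrence: the tail term of `headMatrix_mul_adjMatrix` absorbs one factor of B and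
falls back to layer s with weight D - 1. -/
theorem nonBacktrackingCount_succ_mul_adjMatrix (s : ℕ) :
    G.nonBacktrackingCount (s + 1) * G.adjMatrix ℝ = G.nonBacktrackingCount (s + 2) +
      G.nonBacktrackingCount s * Matrix.diagonal fun u => (G.degree u : ℝ) - 1 := by
  rw [nonBacktrackingCount, Matrix.mul_assoc, headMatrix_mul_adjMatrix, Matrix.mul_add,
    ← Matrix.mul_assoc, ← pow_succ, ← nonBacktrackingCount, pow_succ, Matrix.mul_assoc,
    nonBacktrackingMatrix_mul_tailMatrix, ← Matrix.mul_assoc, ← nonBacktrackingCount]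

theorem sum_nonBacktrackingCount_mul (s : ℕ) (e : G.Dart) (ψ : V → ℝ) :
    ∑ u, G.nonBacktrackingCount s e u * ψ u =
      ∑ f, (G.nonBacktrackingMatrix ℝ ^ s) e f * ψ f.snd := by
  simp_rw [nonBacktrackingCount, Matrix.mul_apply, Finset.sum_mul]
  rw [Finset.sum_comm]
  simp [headMatrix]

theorem sum_nonBacktrackingCount (s : ℕ) (e : G.Dart) :
    ∑ u, G.nonBacktrackingCount s e u = ∑ f, (G.nonBacktrackingMatrix ℝ ^ s) e f := by
  simpa using G.sum_nonBacktrackingCount_mul s e fun _ => 1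

theorem sum_nonBacktrackingCount_mul_degree (s : ℕ) (e : G.Dart) :
    ∑ u, G.nonBacktrackingCount s e u * ((G.degree u : ℝ) - 1) =
      ∑ u, G.nonBacktrackingCount (s + 1) e u := by
  rw [sum_nonBacktrackingCount_mul, sum_nonBacktrackingCount, pow_succ]
  simp_rw [← sum_nonBacktrackingMatrix, Matrix.mul_apply, Finset.mul_sum]
  exact Finset.sum_comm

/-! ### Trial vectors and their quadratic forms -/

/-- The vectors `∑ s < m, aˢ N_s(e, ·)`, where `N_s(e, v)` counts the non-backtracking walks with
`s` steps after the directed edge `e` that end at `v`. -/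
noncomputable def trialMatrix (a : ℝ) (m : ℕ) : Matrix G.Dart V ℝ :=
  ∑ s ∈ Finset.range m, a ^ s • G.nonBacktrackingCount s

theorem trialMatrix_apply (a : ℝ) (m : ℕ) (e : G.Dart) (u : V) :
    G.trialMatrix a m e u = ∑ s ∈ Finset.range m, a ^ s * G.nonBacktrackingCount s e u := by
  simp [trialMatrix, Matrix.sum_apply]

theorem trialMatrix_mul_adjMatrix_apply (a : ℝ) (n : ℕ) (e : G.Dart) (u : V) :
    (G.trialMatrix a (n + 1) * G.adjMatrix ℝ) e u =
      ∑ s ∈ Finset.range (n + 1), a ^ s * G.nonBacktrackingCount (s + 1) e u +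
        G.tailMatrix e u +
        ∑ s ∈ Finset.range n,
          a ^ (s + 1) * (G.nonBacktrackingCount s e u * ((G.degree u : ℝ) - 1)) := by
  rw [trialMatrix, Finset.sum_range_succ', Matrix.add_mul, Matrix.sum_mul]
  simp_rw [Matrix.smul_mul, nonBacktrackingCount_zero_mul_adjMatrix,
    nonBacktrackingCount_succ_mul_adjMatrix]
  rw [Finset.sum_range_succ' _ n]
  simp only [Matrix.add_apply, Matrix.sum_apply, Matrix.smul_apply, smul_eq_mul,
    Matrix.mul_diagonal, mul_add, Finset.sum_add_distrib, pow_zero, one_mul, zero_add]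
  ring

section Girth

variable {G} {m : ℕ} (hg : ((2 * m + 1 : ℕ) : ℕ∞) ≤ G.egirth)

include hg

/-- The case t = m covers the layer just outside the trial vector, which A reaches from the last
layer. -/
theorem trialMatrix_mul_nonBacktrackingCount (a : ℝ) {t : ℕ} (ht : t ≤ m) (e : G.Dart) (u : V) :
    G.trialMatrix a m e u * G.nonBacktrackingCount t e u =
      if t < m then a ^ t * G.nonBacktrackingCount t e u else 0 := by
  rw [trialMatrix_apply, Finset.sum_mul]
  have h : ∀ s ∈ Finset.range m,
      a ^ s * G.nonBacktrackingCount s e u * G.nonBacktrackingCount t e u =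
        if t = s then a ^ s * G.nonBacktrackingCount s e u else 0 := by
    intro s hs
    rw [mul_assoc, G.nonBacktrackingCount_mul (lt_of_lt_of_le ?_ hg) e u]
    · simp [eq_comm]
    · rw [Finset.mem_range] at hs
      exact_mod_cast (by omega)
  rw [Finset.sum_congr rfl h, Finset.sum_ite_eq]
  simp

theorem nonBacktrackingCount_fst_eq_zero (hm : 1 ≤ m) {t : ℕ} (ht : t ≤ m) (e : G.Dart) :
    G.nonBacktrackingCount t e e.fst = 0 :=
  G.nonBacktrackingCount_fst (lt_of_lt_of_le (by exact_mod_cast (by omega)) hg) e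

theorem trialMatrix_fst (a : ℝ) (hm : 1 ≤ m) (e : G.Dart) : G.trialMatrix a m e e.fst = 0 := by
  rw [trialMatrix_apply]
  refine Finset.sum_eq_zero fun s hs => ?_
  rw [nonBacktrackingCount_fst_eq_zero hg hm (Finset.mem_range.1 hs).le, mul_zero]

theorem trialMatrix_mul_self (a : ℝ) (e : G.Dart) (u : V) :
    G.trialMatrix a m e u * G.trialMatrix a m e u =
      ∑ s ∈ Finset.range m, (a ^ 2) ^ s * G.nonBacktrackingCount s e u := by
  conv_lhs =>
    enter [1]
    rw [trialMatrix_apply]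
  rw [Finset.sum_mul]
  refine Finset.sum_congr rfl fun s hs => ?_
  rw [mul_assoc, mul_comm (G.nonBacktrackingCount s e u),
    trialMatrix_mul_nonBacktrackingCount hg a (Finset.mem_range.1 hs).le,
    if_pos (Finset.mem_range.1 hs), pow_right_comm, sq]
  ring

theorem sum_trialMatrix_mul_self (a : ℝ) (e : G.Dart) :
    ∑ u, G.trialMatrix a m e u * G.trialMatrix a m e u =
      ∑ s ∈ Finset.range m, (a ^ 2) ^ s * ∑ u, G.nonBacktrackingCount s e u := by
  simp_rw [trialMatrix_mul_self hg, Finset.mul_sum]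
  exact Finset.sum_comm

theorem sum_trialMatrix_mul_degree_mul (a : ℝ) (e : G.Dart) :
    ∑ u, G.trialMatrix a m e u * ((G.degree u : ℝ) - 1) * G.trialMatrix a m e u =
      ∑ s ∈ Finset.range m, (a ^ 2) ^ s * ∑ u, G.nonBacktrackingCount (s + 1) e u := by
  have h : ∀ u, G.trialMatrix a m e u * ((G.degree u : ℝ) - 1) * G.trialMatrix a m e u =
      ∑ s ∈ Finset.range m,
        (a ^ 2) ^ s * (G.nonBacktrackingCount s e u * ((G.degree u : ℝ) - 1)) := fun u => by
    rw [mul_right_comm, trialMatrix_mul_self hg, Finset.sum_mul]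
    simp_rw [mul_assoc]
  simp_rw [h, ← sum_nonBacktrackingCount_mul_degree, Finset.mul_sum]
  exact Finset.sum_comm

end Girth

/-- A links only consecutive layers, each link counted in both directions. There are n + 1 layers
but only n links; the missing one produces the error term -2√ρ z/m. -/
theorem sum_trialMatrix_mul_adjMatrix_mul {n : ℕ}
    (hg : ((2 * (n + 1) + 1 : ℕ) : ℕ∞) ≤ G.egirth) (a : ℝ) (e : G.Dart) :
    ∑ u, (G.trialMatrix a (n + 1) * G.adjMatrix ℝ) e u * G.trialMatrix a (n + 1) e u =
      ∑ s ∈ Finset.range n, 2 * a * (a ^ 2) ^ s * ∑ u, G.nonBacktrackingCount (s + 1) e u := by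
  have key : ∀ u, (G.trialMatrix a (n + 1) * G.adjMatrix ℝ) e u * G.trialMatrix a (n + 1) e u =
      ∑ s ∈ Finset.range n, a * (a ^ 2) ^ s * (G.nonBacktrackingCount (s + 1) e u +
        G.nonBacktrackingCount s e u * ((G.degree u : ℝ) - 1)) := by
    intro u
    have htail : G.tailMatrix e u * G.trialMatrix a (n + 1) e u = 0 := by
      simp only [tailMatrix, Matrix.of_apply]
      split_ifs with h
      · rw [← h, trialMatrix_fst hg a (by omega), mul_zero]
      · rw [zero_mul]
    -- The tail term and the upward term leaving the last layer both land outside the support of the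
    -- trial vector.
    rw [trialMatrix_mul_adjMatrix_apply, add_mul, add_mul, htail, add_zero,
      Finset.sum_range_succ, add_mul, mul_assoc (a ^ n),
      mul_comm (G.nonBacktrackingCount (n + 1) e u),
      trialMatrix_mul_nonBacktrackingCount hg a le_rfl, if_neg (lt_irrefl _), mul_zero, add_zero,
      Finset.sum_mul, Finset.sum_mul, ← Finset.sum_add_distrib]
    refine Finset.sum_congr rfl fun s hs => ?_
    have hs := Finset.mem_range.1 hs
    have h1 := trialMatrix_mul_nonBacktrackingCount hg a (t := s + 1) (by omega) e u
    have h2 := trialMatrix_mul_nonBacktrackingCount hg a (t := s) (by omega) e u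
    rw [if_pos (by omega)] at h1 h2
    linear_combination a ^ s * h1 + a ^ (s + 1) * ((G.degree u : ℝ) - 1) * h2
  simp_rw [key]
  rw [Finset.sum_comm]
  refine Finset.sum_congr rfl fun s _ => ?_
  rw [← Finset.mul_sum, Finset.sum_add_distrib, sum_nonBacktrackingCount_mul_degree]
  ring

theorem mul_deformedLaplacian_apply {ι : Type*} (F : Matrix ι V ℝ) (z : ℝ) (e : ι) (u : V) :
    (F * G.deformedLaplacian z) e u = z ^ 2 * F e u - z * (F * G.adjMatrix ℝ) e u +
      F e u * ((G.degree u : ℝ) - 1) := by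
  simp only [deformedLaplacian, degMatrix, Matrix.mul_sub, Matrix.mul_add, Matrix.mul_smul,
    Matrix.mul_one, Matrix.sub_apply, Matrix.add_apply, Matrix.smul_apply, smul_eq_mul,
    Matrix.mul_diagonal]
  ring

/-- This is wᵀBˢ𝟙 = rˢ wᵀ𝟙: individual layers may grow irregularly, but their `w`-average is exactly
geometric. -/
theorem sum_eigenvector_mul_nonBacktrackingCount {w : G.Dart → ℝ} {r : ℝ}
    (hw : (G.nonBacktrackingMatrix ℝ).transpose.mulVec w = r • w) (s : ℕ) :
    ∑ e, w e * ∑ u, G.nonBacktrackingCount s e u = r ^ s * ∑ e, w e := by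
  simp_rw [sum_nonBacktrackingCount]
  induction s with
  | zero => simp [Matrix.one_apply]
  | succ s ih =>
    have h : ∀ f, ∑ e, w e * G.nonBacktrackingMatrix ℝ e f = r * w f := fun f => by
      simpa [Matrix.mulVec, dotProduct, mul_comm] using congrFun hw f
    calc ∑ e, w e * ∑ f, (G.nonBacktrackingMatrix ℝ ^ (s + 1)) e f
        = ∑ g, (∑ e, w e * G.nonBacktrackingMatrix ℝ e g) *
            ∑ f, (G.nonBacktrackingMatrix ℝ ^ s) g f := by
          simp_rw [Finset.sum_mul]
          rw [Finset.sum_comm]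
          refine Finset.sum_congr rfl fun e _ => ?_
          simp_rw [pow_succ', Matrix.mul_apply, mul_assoc, ← Finset.mul_sum]
          rw [Finset.sum_comm]
          simp_rw [← Finset.mul_sum]
      _ = r ^ (s + 1) * ∑ e, w e := by
          simp_rw [h, mul_assoc]
          rw [← Finset.mul_sum, ih]
          ring

/-- The weighted Rayleigh identity. -/
theorem sum_mul_trialMatrix_mul_deformedLaplacian {n : ℕ}
    (hg : ((2 * (n + 1) + 1 : ℕ) : ℕ∞) ≤ G.egirth) {w : G.Dart → ℝ} {r : ℝ} (hr : 0 < r)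
    (hw : (G.nonBacktrackingMatrix ℝ).transpose.mulVec w = r • w) (z : ℝ) :
    ∑ e, w e * (G.trialMatrix (-(√r)⁻¹) (n + 1) * G.deformedLaplacian z *
        (G.trialMatrix (-(√r)⁻¹) (n + 1)).transpose) e e =
      ((n + 1) * (z ^ 2 + r) + 2 * n * √r * z) * ∑ e, w e := by
  have hs : 0 < √r := Real.sqrt_pos.2 hr
  have hsr : √r * √r = r := Real.mul_self_sqrt hr.le
  -- The modulus gives all layers equal averaged mass; the negative sign makes the adjacency
  -- contribution negative when z < 0.
  set a := -(√r)⁻¹ with ha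
  have ha2 : a ^ 2 * r = 1 := by
    rw [ha, neg_sq, inv_pow, sq, hsr, inv_mul_cancel₀ hr.ne']
  have har : a * r = -√r := by
    rw [ha]
    field_simp
    rw [sq, hsr]
  have hpow : ∀ s : ℕ, (a ^ 2) ^ s * r ^ s = 1 := fun s => by rw [← mul_pow, ha2, one_pow]
  have hform : ∀ e, (G.trialMatrix a (n + 1) * G.deformedLaplacian z *
      (G.trialMatrix a (n + 1)).transpose) e e =
      z ^ 2 * (∑ s ∈ Finset.range (n + 1), (a ^ 2) ^ s * ∑ u, G.nonBacktrackingCount s e u) -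
      z * (∑ s ∈ Finset.range n, 2 * a * (a ^ 2) ^ s *
        ∑ u, G.nonBacktrackingCount (s + 1) e u) +
      ∑ s ∈ Finset.range (n + 1), (a ^ 2) ^ s * ∑ u, G.nonBacktrackingCount (s + 1) e u := by
    intro e
    rw [← sum_trialMatrix_mul_self hg, ← G.sum_trialMatrix_mul_adjMatrix_mul hg,
      ← sum_trialMatrix_mul_degree_mul hg, Finset.mul_sum, Finset.mul_sum,
      ← Finset.sum_sub_distrib, ← Finset.sum_add_distrib, Matrix.mul_apply]
    refine Finset.sum_congr rfl fun u _ => ?_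
    rw [mul_deformedLaplacian_apply, Matrix.transpose_apply]
    ring
  have hswap : ∀ (k : ℕ) (b : ℕ → ℝ) (j : ℕ),
      ∑ e, w e * ∑ s ∈ Finset.range k, b s * ∑ u, G.nonBacktrackingCount (s + j) e u =
        ∑ s ∈ Finset.range k, b s * (r ^ (s + j) * ∑ e, w e) := by
    intro k b j
    simp_rw [← G.sum_eigenvector_mul_nonBacktrackingCount hw, Finset.mul_sum (Finset.range k)]
    rw [Finset.sum_comm]
    refine Finset.sum_congr rfl fun s _ => ?_
    rw [Finset.mul_sum]
    exact Finset.sum_congr rfl fun e _ => by ring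
  simp_rw [hform, mul_add, mul_sub, Finset.sum_add_distrib, Finset.sum_sub_distrib,
    mul_left_comm (w _), ← Finset.mul_sum]
  have h0 := hswap (n + 1) (fun s => (a ^ 2) ^ s) 0
  simp only [add_zero] at h0
  rw [h0, hswap (n + 1) (fun s => (a ^ 2) ^ s) 1, hswap n (fun s => 2 * a * (a ^ 2) ^ s) 1]
  have e1 : ∀ s : ℕ, (a ^ 2) ^ s * (r ^ s * ∑ e, w e) = ∑ e, w e := fun s => by
    rw [← mul_assoc, hpow, one_mul]
  have e2 : ∀ s : ℕ, (a ^ 2) ^ s * (r ^ (s + 1) * ∑ e, w e) = r * ∑ e, w e := fun s => by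
    linear_combination (r * ∑ e, w e) * hpow s
  have e3 : ∀ s : ℕ, 2 * a * (a ^ 2) ^ s * (r ^ (s + 1) * ∑ e, w e) = -2 * √r * ∑ e, w e :=
    fun s => by linear_combination (2 * a * r * ∑ e, w e) * hpow s + 2 * (∑ e, w e) * har
  simp_rw [e1, e2, e3]
  simp
  ring

end SimpleGraph

/-! ### The left Perron vector and the degenerate case ρ = 0 -/

theorem Matrix.spectralRadius_transpose {n : Type*} [Fintype n] [DecidableEq n]
    (A : Matrix n n ℂ) : spectralRadius ℂ A.transpose = spectralRadius ℂ A := by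
  have h : spectrum ℂ A.transpose = spectrum ℂ A := by
    ext μ
    rw [spectrum.mem_iff, spectrum.mem_iff, ← Matrix.isUnit_transpose]
    simp [Matrix.transpose_sub, Algebra.algebraMap_eq_smul_one]
  rw [spectralRadius, spectralRadius, h]

theorem Matrix.spectralRadius_ne_top {n : Type*} [Fintype n] [DecidableEq n] [Nonempty n]
    (A : Matrix n n ℂ) : spectralRadius ℂ A ≠ ⊤ := by
  let _ : NormedRing (Matrix n n ℂ) := Matrix.linftyOpNormedRing
  let _ : NormedAlgebra ℂ (Matrix n n ℂ) := Matrix.linftyOpNormedAlgebra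
  have _ : CompleteSpace (Matrix n n ℂ) := FiniteDimensional.complete ℂ _
  obtain ⟨μ, -, hμ⟩ := spectrum.exists_nnnorm_eq_spectralRadius A
  rw [← hμ]
  exact ENNReal.coe_ne_top

namespace SimpleGraph

variable {V : Type*} [Fintype V] [DecidableEq V] (G : SimpleGraph V) [DecidableRel G.Adj]

omit [Fintype V] [DecidableRel G.Adj] in
theorem nonBacktrackingMatrix_map_ofReal :
    (G.nonBacktrackingMatrix ℝ).map Complex.ofReal = G.nonBacktrackingMatrix ℂ := by
  ext e f
  simp [nonBacktrackingMatrix, apply_ite Complex.ofReal]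

theorem nonempty_dart_of_radius_pos (h : 0 < G.nonBacktrackingRadius) : Nonempty G.Dart := by
  by_contra hne
  rw [not_nonempty_iff] at hne
  refine h.ne' ?_
  have : Subsingleton (Matrix G.Dart G.Dart ℂ) := inferInstance
  simp [nonBacktrackingRadius, spectralRadius, spectrum.of_subsingleton]

theorem exists_nonneg_left_eigenvector [Nonempty G.Dart] :
    ∃ w : G.Dart → ℝ, 0 ≤ w ∧ w ≠ 0 ∧
      (G.nonBacktrackingMatrix ℝ).transpose.mulVec w = G.nonBacktrackingRadius • w := by
  have h := Matrix.exists_nonneg_eigenvector (M := (G.nonBacktrackingMatrix ℝ).transpose)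
    fun i j => G.nonBacktrackingMatrix_nonneg j i
  rwa [Matrix.transpose_map, nonBacktrackingMatrix_map_ofReal,
    Matrix.spectralRadius_transpose] at h

open Filter Topology in
-- Row sums of B are degrees minus one, hence at least 1, and this persists for all powers; spectral
-- radius 0 would force the powers to tend to 0.
theorem radius_pos_of_two_le_degree [Nonempty V] (h : ∀ v, 2 ≤ G.degree v) :
    0 < G.nonBacktrackingRadius := by
  obtain ⟨v⟩ := ‹Nonempty V›
  obtain ⟨u, hu⟩ := (G.degree_pos_iff_exists_adj v).1 (by have := h v; omega)
  let e : G.Dart := ⟨(v, u), hu⟩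
  have : Nonempty G.Dart := ⟨e⟩
  refine ENNReal.toReal_nonneg.lt_of_ne' fun h0 => ?_
  -- `toReal` also vanishes at `⊤`, so finiteness of the spectral radius is needed here.
  have hρ : spectralRadius ℂ (G.nonBacktrackingMatrix ℂ) = 0 :=
    (ENNReal.toReal_eq_zero_iff _).1 h0 |>.resolve_right (Matrix.spectralRadius_ne_top _)
  have hge : ∀ (k : ℕ) (d : G.Dart), 1 ≤ ∑ f, (G.nonBacktrackingMatrix ℝ ^ k) d f := by
    intro k
    induction k with
    | zero => simp [Matrix.one_apply]
    | succ k ih =>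
      intro d
      simp_rw [pow_succ', Matrix.mul_apply]
      rw [Finset.sum_comm]
      simp_rw [← Finset.mul_sum]
      calc (1 : ℝ) ≤ (G.degree d.snd : ℝ) - 1 := by
            have : (2 : ℝ) ≤ G.degree d.snd := by exact_mod_cast h d.snd
            linarith
        _ = ∑ f, G.nonBacktrackingMatrix ℝ d f * 1 := by
            simp_rw [mul_one, sum_nonBacktrackingMatrix]
        _ ≤ _ := Finset.sum_le_sum fun f _ =>
            mul_le_mul_of_nonneg_left (ih f) (G.nonBacktrackingMatrix_nonneg d f)
  have hlim : Tendsto (fun k => ∑ f, (G.nonBacktrackingMatrix ℝ ^ k) e f) atTop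
      (𝓝 (∑ _f : G.Dart, 0)) := by
    refine tendsto_finsetSum _ fun f _ => ?_
    have hsum := Matrix.summable_pow_div_of_spectralRadius_lt (G.nonBacktrackingMatrix ℝ) (t := 1)
      (by rw [nonBacktrackingMatrix_map_ofReal, hρ]; simp) e f
    simpa using hsum.tendsto_atTop_zero
  have := ge_of_tendsto' hlim fun k => hge k e
  norm_num at this

theorem deformedLaplacian_apply_self (z : ℝ) (v : V) :
    G.deformedLaplacian z v v = z ^ 2 + (G.degree v : ℝ) - 1 := by
  simp [deformedLaplacian, degMatrix]

theorem deformedLaplacian_apply_of_adj (z : ℝ) {u v : V} (h : G.Adj u v) :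
    G.deformedLaplacian z u v = -z := by
  simp [deformedLaplacian, degMatrix, h, h.ne]

/-- The diagonal entry at `v` is its degree minus one. Degree 0 makes it negative; degree 1 makes it
zero, which would put the coordinate vector in the kernel, yet its image has entry -z at the
neighbour. -/
theorem not_posSemidef_deformedLaplacian_sub_sq {v : V} (hv : G.degree v ≤ 1) {z : ℝ}
    (hz : z < 0) : ¬ (G.deformedLaplacian z - z ^ 2 • (1 : Matrix V V ℝ)).PosSemidef := by
  intro h
  have hdiag := h.diag_nonneg (i := v)
  simp only [Matrix.sub_apply, deformedLaplacian_apply_self, Matrix.smul_apply,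
    Matrix.one_apply_eq, smul_eq_mul, mul_one] at hdiag
  have hdeg : G.degree v = 1 := by
    refine le_antisymm hv ?_
    have : (1 : ℝ) ≤ G.degree v := by linarith
    exact_mod_cast this
  obtain ⟨u, hu⟩ := (G.degree_pos_iff_exists_adj v).1 (by omega)
  have hker := (h.dotProduct_mulVec_zero_iff (Pi.single v 1)).1 (by
    simp [deformedLaplacian_apply_self, hdeg])
  have := congrFun hker u
  simp [G.deformedLaplacian_apply_of_adj z hu.symm, hu.ne', hz.ne] at this

/-! ### The Gram matrix of the trial vectors and strictness -/

/-- The average of the outer products of the trial vectors, weighted by `w`. -/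
noncomputable def trialGram (a : ℝ) (m : ℕ) (w : G.Dart → ℝ) : Matrix V V ℝ :=
  (G.trialMatrix a m).transpose * Matrix.diagonal w * G.trialMatrix a m

theorem trialGram_posSemidef (a : ℝ) (m : ℕ) {w : G.Dart → ℝ} (hw : 0 ≤ w) :
    (G.trialGram a m w).PosSemidef := by
  have h := (Matrix.PosSemidef.diagonal hw).conjTranspose_mul_mul_same (G.trialMatrix a m)
  rwa [Matrix.conjTranspose_eq_transpose_of_trivial] at h

theorem trace_trialGram_mul (a : ℝ) (m : ℕ) (w : G.Dart → ℝ) (M : Matrix V V ℝ) :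
    (G.trialGram a m w * M).trace =
      ∑ e, w e * (G.trialMatrix a m * M * (G.trialMatrix a m).transpose) e e := by
  rw [trialGram, Matrix.mul_assoc, Matrix.mul_assoc, Matrix.trace_mul_comm, Matrix.mul_assoc,
    Matrix.trace]
  simp [Matrix.diagonal_mul]

theorem trace_trialGram {n : ℕ} (hg : ((2 * (n + 1) + 1 : ℕ) : ℕ∞) ≤ G.egirth)
    {w : G.Dart → ℝ} {r : ℝ} (hr : 0 < r)
    (hw : (G.nonBacktrackingMatrix ℝ).transpose.mulVec w = r • w) :
    (G.trialGram (-(√r)⁻¹) (n + 1) w).trace = (n + 1) * ∑ e, w e := by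
  have ha : ((-(√r)⁻¹) ^ 2) * r = 1 := by
    rw [neg_sq, inv_pow, Real.sq_sqrt hr.le, inv_mul_cancel₀ hr.ne']
  rw [← Matrix.mul_one (G.trialGram _ _ _), trace_trialGram_mul]
  simp_rw [Matrix.mul_one, Matrix.mul_apply, Matrix.transpose_apply, sum_trialMatrix_mul_self hg,
    Finset.mul_sum (Finset.range _), mul_left_comm (w _)]
  rw [Finset.sum_comm]
  simp_rw [← Finset.mul_sum Finset.univ, G.sum_eigenvector_mul_nonBacktrackingCount hw,
    ← mul_assoc, ← mul_pow, ha]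
  simp

/-- Trial vectors are not eigenvectors of the deformed Laplacian. -/
theorem trialMatrix_mul_deformedLaplacian_fst {n : ℕ}
    (hg : ((2 * (n + 1) + 1 : ℕ) : ℕ∞) ≤ G.egirth) (a z c : ℝ) (e : G.Dart) :
    (G.trialMatrix a (n + 1) * (G.deformedLaplacian z - c • (1 : Matrix V V ℝ))) e e.fst =
      -z := by
  have h0 := trialMatrix_fst hg a (by omega) e
  rw [Matrix.mul_sub, Matrix.sub_apply, mul_deformedLaplacian_apply, h0,
    trialMatrix_mul_adjMatrix_apply, Finset.sum_eq_zero, Finset.sum_eq_zero]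
  · simp [tailMatrix, h0]
  · intro s hs
    have := Finset.mem_range.1 hs
    rw [nonBacktrackingCount_fst_eq_zero hg (by omega) (by omega)]
    simp
  · intro s hs
    have := Finset.mem_range.1 hs
    rw [nonBacktrackingCount_fst_eq_zero hg (by omega) (by omega)]
    simp

/-- A vanishing weighted sum of nonnegative quadratic forms puts some trial vector with nonzero
weight in the kernel, contradicting `trialMatrix_mul_deformedLaplacian_fst`. -/
theorem not_posSemidef_of_sum_eq_zero {n : ℕ}
    (hg : ((2 * (n + 1) + 1 : ℕ) : ℕ∞) ≤ G.egirth) {a z c : ℝ} (hz : z < 0)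
    {w : G.Dart → ℝ} (hw : 0 ≤ w) (hw0 : w ≠ 0)
    (hsum : (G.trialGram a (n + 1) w *
      (G.deformedLaplacian z - c • (1 : Matrix V V ℝ))).trace = 0) :
    ¬ (G.deformedLaplacian z - c • (1 : Matrix V V ℝ)).PosSemidef := by
  intro hM
  have hfst := G.trialMatrix_mul_deformedLaplacian_fst hg a z c
  rw [trace_trialGram_mul] at hsum
  generalize G.deformedLaplacian z - c • (1 : Matrix V V ℝ) = M at *
  set F := G.trialMatrix a (n + 1)
  have hq : ∀ e, (F * M * F.transpose) e e = star (F e) ⬝ᵥ M.mulVec (F e) := by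
    intro e
    rw [star_trivial, Matrix.dotProduct_mulVec]
    rfl
  have hnn : ∀ e, 0 ≤ (F * M * F.transpose) e e := fun e => by
    rw [hq]
    exact hM.dotProduct_mulVec_nonneg (F e)
  obtain ⟨e, he⟩ := Function.ne_iff.1 hw0
  have hz0 := (Finset.sum_eq_zero_iff_of_nonneg
    fun e _ => mul_nonneg (hw e) (hnn e)).1 hsum e (Finset.mem_univ e)
  have hker := (hM.dotProduct_mulVec_zero_iff (F e)).1
    ((hq e).symm.trans ((mul_eq_zero.1 hz0).resolve_left he))
  have hsymm : M.transpose = M := by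
    simpa [Matrix.conjTranspose_eq_transpose_of_trivial] using hM.isHermitian.eq
  have h1 : (F * M) e e.fst = M.mulVec (F e) e.fst := by
    rw [← Matrix.vecMul_transpose, hsymm]
    rfl
  rw [hfst, hker] at h1
  exact hz.ne (by simpa using h1)

end SimpleGraph

/-! ### Combining the cases ρ = 0 and ρ > 0 -/

theorem corollary5 {V : Type*} [Fintype V] [DecidableEq V] [Nonempty V]
    (G : SimpleGraph V) [DecidableRel G.Adj] (m : ℕ) (hm : 1 ≤ m)
    (hgirth : ((2 * m + 1 : ℕ) : ℕ∞) ≤ G.egirth) :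
    (∀ z : ℝ, z < 0 →
      ¬ (G.deformedLaplacian z -
          ((z + √G.nonBacktrackingRadius) ^ 2 - 2 * √G.nonBacktrackingRadius * z / m) •
            (1 : Matrix V V ℝ)).PosSemidef) ∧
    ∃ X : Matrix V V ℝ, X.PosSemidef ∧ X.trace = 1 ∧
      ∀ z : ℝ, z < 0 →
        (X * G.deformedLaplacian z).trace ≤
          (z + √G.nonBacktrackingRadius) ^ 2 - 2 * √G.nonBacktrackingRadius * z / m := by
  have hr0 : 0 ≤ G.nonBacktrackingRadius := ENNReal.toReal_nonneg
  rcases hr0.eq_or_lt with h0 | hr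
  · obtain ⟨v, hv⟩ : ∃ v, G.degree v ≤ 1 := by
      by_contra! h
      exact (G.radius_pos_of_two_le_degree h).ne h0
    rw [← h0]
    refine ⟨fun z hz => by simpa using G.not_posSemidef_deformedLaplacian_sub_sq hv hz,
      Matrix.single v v 1, ?_, by simp, fun z _ => ?_⟩
    · rw [← Matrix.diagonal_single]
      exact Matrix.PosSemidef.diagonal (Pi.single_nonneg.2 zero_le_one)
    · have : (G.degree v : ℝ) ≤ 1 := by exact_mod_cast hv
      rw [Matrix.trace_single_mul, G.deformedLaplacian_apply_self]
      simp
      linarith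
  · have := G.nonempty_dart_of_radius_pos hr
    obtain ⟨w, hw, hw0, heig⟩ := G.exists_nonneg_left_eigenvector
    set r := G.nonBacktrackingRadius
    obtain ⟨n, rfl⟩ := Nat.exists_eq_add_of_le' hm
    have hW : 0 < ∑ e, w e := by
      obtain ⟨e, he⟩ := Function.ne_iff.1 hw0
      exact Finset.sum_pos' (fun e _ => hw e) ⟨e, Finset.mem_univ e, (hw e).lt_of_ne' he⟩
    have hT := G.trace_trialGram hgirth hr heig
    have hpos : 0 < ((n : ℝ) + 1) * ∑ e, w e := by positivity
    -- The bound holds with equality before normalisation, by a Gram matrix that does not depend on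
    -- `z`; this yields both the uniform X and the zero trace needed for strictness.
    have hL : ∀ z, (G.trialGram (-(√r)⁻¹) (n + 1) w * G.deformedLaplacian z).trace =
        ((z + √r) ^ 2 - 2 * √r * z / (n + 1 : ℕ)) * ((n + 1) * ∑ e, w e) := by
      intro z
      rw [G.trace_trialGram_mul, G.sum_mul_trialMatrix_mul_deformedLaplacian hgirth hr heig]
      push_cast
      field_simp
      linear_combination (-(n : ℝ) - 1) * Real.sq_sqrt hr.le
    refine ⟨fun z hz => G.not_posSemidef_of_sum_eq_zero hgirth (a := -(√r)⁻¹) hz hw hw0 ?_,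
      (((n : ℝ) + 1) * ∑ e, w e)⁻¹ • G.trialGram (-(√r)⁻¹) (n + 1) w,
      (G.trialGram_posSemidef _ _ hw).smul (inv_nonneg.2 hpos.le), ?_, fun z _ => le_of_eq ?_⟩
    · rw [Matrix.mul_sub, Matrix.trace_sub, hL, Matrix.mul_smul, Matrix.trace_smul, Matrix.mul_one,
        hT, smul_eq_mul, sub_self]
    · rw [Matrix.trace_smul, hT, smul_eq_mul, inv_mul_cancel₀ hpos.ne']
    · rw [Matrix.smul_mul, Matrix.trace_smul, hL, smul_eq_mul, mul_comm, mul_assoc,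
        mul_inv_cancel₀ hpos.ne', mul_one]
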